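/- **Theorem.** Let $\mathit{Act}$ be a set of actions, $\mathit{Key}$ a set of communication keys, and $\mathit{Rate}=\mathbb R_{>0}$. Let the processes of the calculus RMPC be generated by $P,Q ::= 0 \mid \langle a,\lambda\rangle.P \mid P+Q \mid P\parallel_L Q$ (standard processes) and $R,S ::= P \mid \langle a,\lambda\rangle[i].R \mid R+S \mid R\parallel_L S$, with $a\in \mathit{Act}$, $\lambda\in \mathit{Rate}$, $i\in \mathit{Key}$, $L\subseteq \mathit{Act}$. Write $\mathrm{key}(R)$ for the set of keys in $R$. Fix an arbitrary positive backward rate $\overline{\lambda}=\overline{\lambda}_a\in\mathbb R_{>0}$ for every action $\langle a,\lambda\rangle$. Forward transitions are generated by the rules: * $\langle a,\lambda\rangle.R \xrightarrow{\langle a,\lambda\rangle[i]} \langle a,\lambda\rangle[i].R$ if $R$ is standard; * $\langle a,\lambda\rangle[i].R \xrightarrow{\langle b,\mu\rangle[j]} \langle a,\lambda\rangle[i].R'$ if $R\xrightarrow{\langle b,\mu\rangle[j]}R'$ and $j\ne i$; * $R+S \xrightarrow{\langle a,\lambda\rangle[i]} R'+S$ if $R\xrightarrow{\langle a,\lambda\rangle[i]}R'$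 and $S$ is standard, and symmetrically; * $R\parallel_L S \xrightarrow{\langle a,\lambda\rangle[i]} R'\parallel_L S$ if $R\xrightarrow{\langle a,\lambda\rangle[i]}R'$, $a\notin L$ and $i\notin\mathrm{key}(S)$, and symmetrically; * $R\parallel_L S \xrightarrow{\langle a,\lambda\mu\rangle[i]} R'\parallel_L S'$ if $R\xrightarrow{\langle a,\lambda\rangle[i]}R'$, $S\xrightarrow{\langle a,\mu\rangle[i]}S'$ and $a\in L$. Backward transitions are generated by $\langle a,\lambda\rangle[i].R \dashrightarrow \langle a,\lambda\rangle.R$ with label $\langle a,\overline\lambda\rangle[i]$ if $R$ is standard, together with the analogues of the other four rules (with $\overline\lambda\cdot\overline\mu$ in the last one). A process is reachable if it is obtained from a standard process by finitely many forward transitions. Let $\equiv$ be the smallest equivalence relation on reachable processes such that ($\mathcal C,\mathcal C_k$ denoting processes with one hole which is not in the scope of an unkeyed prefix): * $\mathcal C[\langle a,\lambda\rangle[i].R]\equiv\mathcal C[\langle a,\lambda\rangle[j].R]$ if $\mathcal C$ contains no $\parallel_L$ with $a\in L$ and $i,j$ do not occur in $\mathcal C,R$; * if $a\in L_1\cap\dots\cap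 L_{n-1}$, $n\ge 2$, and $i,j$ do not occur in $\mathcal C,\mathcal C_k,R_k$, then $\mathcal C[\mathcal C_1[\langle a,\lambda_1\rangle[i].R_1]\parallel_{L_1}\dots\parallel_{L_{n-1}}\mathcal C_n[\langle a,\lambda_n\rangle[i].R_n]]\equiv \mathcal C[\mathcal C_1[\langle a,\lambda_1\rangle[j].R_1]\parallel_{L_1}\dots\parallel_{L_{n-1}}\mathcal C_n[\langle a,\lambda_n\rangle[j].R_n]]$, for any bracketing. For a reachable process $R$, the Markov chain $\mathcal M[\![R]\!]$ underlying $R$ has as states the $\equiv$-classes that can be reached from $[R]$ through forward and backward transitions between representatives. Its transitions are these transitions with their keys dropped from the labels, and the rate $q_{s,s'}$ from $s$ to $s'\ne s$ is the sum of the rates labeling the transitions from $s$ to $s'$. If parallel composition does not occur in the reachable process $R$, then, whatever the backward rates are, $\mathcal M[\![R]\!]$ has finitely many states and transitions, it is irreducible (hence ergodic), it has a unique steady-state distribution $\pi$ (i.e. $\pi(s)>0$ for all $s$, $\sum_s\pi(s)=1$ and $\pi(s)\sum_{s'\neq s}q_{s,s'}=\sum_{s'\ne s}\pi(s')q_{s',s}$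 for all $s$), and $\mathcal M[\![R]\!]$ in equilibrium is stationary and time reversible. The latter means that every time-homogeneous continuous-time Markov chain $(X(t))_{t\ge 0}$ on the states of $\mathcal M[\![R]\!]$ with $\lim_{h\to0^+}\Pr\{X(t+h)=s'\mid X(t)=s\}/h=q_{s,s'}$ whenever $s\ne s'$ and $\Pr\{X(t)=s\}>0$, and with $\Pr\{X(0)=s\}=\pi(s)$ for all $s$, is stationary, and for all $n\geq 1$, all times $0\le t_1<\dots<t_n$ and all $t'\ge t_n$ the vectors $(X(t_i))_{1\le i\le n}$ and $(X(t'-t_i))_{1\le i\le n}$ have the same joint distribution. -/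

import Mathlib

open MeasureTheory ProbabilityTheory Filter Topology
open scoped NNReal

universe u v w

/-! ### Continuous-time Markov chains, stationarity and time reversibility -/

namespace CTMC

variable {Ω : Type w} {S : Type u} [MeasurableSpace Ω] [MeasurableSpace S]

/-- `X` is a continuous-time Markov chain on the discrete state space `S`: the conditional law of
the next observation given finitely many past ones only depends on the last of them. -/
structure IsMarkovChain (μ : Measure Ω) (X : ℝ≥0 → Ω → S) : Prop where
  measurable : ∀ t, Measurable (X t)
  markov : ∀ (n : ℕ) (t : Fin (n + 2) → ℝ≥0), StrictMono t → ∀ s : Fin (n + 2) → S,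
    μ {ω | ∀ i : Fin (n + 1), X (t i.castSucc) ω = s i.castSucc} ≠ 0 →
    cond μ {ω | ∀ i : Fin (n + 1), X (t i.castSucc) ω = s i.castSucc}
        {ω | X (t (Fin.last (n + 1))) ω = s (Fin.last (n + 1))}
      = cond μ {ω | X (t (Fin.last n).castSucc) ω = s (Fin.last n).castSucc}
        {ω | X (t (Fin.last (n + 1))) ω = s (Fin.last (n + 1))}

/-- The probabilities `Pr(X (t + h) = s' | X t = s)` do not depend on `t` (among the times `t` at
which they are defined). -/
def IsTimeHomogeneous (μ : Measure Ω) (X : ℝ≥0 → Ω → S) : Prop :=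
  ∀ (t t' h : ℝ≥0) (s s' : S), μ {ω | X t ω = s} ≠ 0 → μ {ω | X t' ω = s} ≠ 0 →
    cond μ {ω | X t ω = s} {ω | X (t + h) ω = s'} =
      cond μ {ω | X t' ω = s} {ω | X (t' + h) ω = s'}

/-- `X` moves from `s` to `s' ≠ s` at rate `q s s'`, the limit of
`Pr(X (t + h) = s' | X t = s) / h` as `h` tends to `0` from above. -/
def HasRates (μ : Measure Ω) (X : ℝ≥0 → Ω → S) (q : S → S → ℝ) : Prop :=
  ∀ (t : ℝ≥0) (s s' : S), s ≠ s' → μ {ω | X t ω = s} ≠ 0 →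
    Tendsto (fun h : ℝ≥0 => (cond μ {ω | X t ω = s}).real {ω | X (t + h) ω = s'} / (h : ℝ))
      (𝓝[>] 0) (𝓝 (q s s'))

/-- Finite-dimensional distributions are invariant under time shifts. -/
def IsStationary (μ : Measure Ω) (X : ℝ≥0 → Ω → S) : Prop :=
  ∀ (n : ℕ) (t : Fin n → ℝ≥0), StrictMono t → ∀ t' : ℝ≥0,
    IdentDistrib (fun ω i => X (t i + t') ω) (fun ω i => X (t i) ω) μ μ

/-- Finite-dimensional distributions are invariant under reversing the direction of time: for all
times `t₁ < ⋯ < tₙ` and all `t'` for which the reversed times `t' - tᵢ` are non-negative,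
`(X t₁, …, X tₙ)` and `(X (t' - t₁), …, X (t' - tₙ))` have the same joint distribution. -/
def IsTimeReversible (μ : Measure Ω) (X : ℝ≥0 → Ω → S) : Prop :=
  ∀ (n : ℕ) (t : Fin n → ℝ≥0), StrictMono t → ∀ t' : ℝ≥0, (∀ i, t i ≤ t') →
    IdentDistrib (fun ω i => X (t i) ω) (fun ω i => X (t' - t i) ω) μ μ

/-- `p` is a steady-state distribution for the rates `q` on a finite state space: a strictly
positive probability vector that satisfies the global balance equations. -/
def IsSteadyState {S : Type u} (q : S → S → ℝ) (p : S → ℝ) : Prop :=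
  (∀ s, 0 < p s) ∧ ∑ᶠ s, p s = 1 ∧
    ∀ s, p s * ∑ᶠ (s') (_ : s' ≠ s), q s s' = ∑ᶠ (s') (_ : s' ≠ s), p s' * q s' s

end CTMC

/-! ### The calculus -/

namespace RMPC

/-- Rates are positive real numbers. -/
abbrev Rate : Type := {r : ℝ // 0 < r}

/-- Raw terms over actions `Act` and communication keys `Key`: the terminated process `0`, the
prefixes `<a,r>.P` and `<a,r>[i].P`, the choice `P + Q`, the parallel composition `P ∥_L Q`. -/
inductive Proc (Act : Type u) (Key : Type v) : Type (max u v)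
  | nil : Proc Act Key
  | pre : Act → Rate → Proc Act Key → Proc Act Key
  | past : Act → Rate → Key → Proc Act Key → Proc Act Key
  | choice : Proc Act Key → Proc Act Key → Proc Act Key
  | par : Set Act → Proc Act Key → Proc Act Key → Proc Act Key

namespace Proc

variable {Act : Type u} {Key : Type v}

/-- Standard forward processes: no prefix carries a key. -/
def Std : Proc Act Key → Prop
  | nil => True
  | pre _ _ P => P.Std
  | past _ _ _ _ => False
  | choice P Q => P.Std ∧ Q.Std
  | par _ P Q => P.Std ∧ Q.Std

/-- The set of keys that occur in a process. -/
def keys : Proc Act Key → Set Key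
  | nil => ∅
  | pre _ _ P => P.keys
  | past _ _ i P => insert i P.keys
  | choice P Q => P.keys ∪ Q.keys
  | par _ P Q => P.keys ∪ Q.keys

/-- Parallel composition does not occur in the process. -/
def ParFree : Proc Act Key → Prop
  | nil => True
  | pre _ _ P => P.ParFree
  | past _ _ _ P => P.ParFree
  | choice P Q => P.ParFree ∧ Q.ParFree
  | par _ _ _ => False

/-- The process contains no parallel composition that synchronizes on `a`. -/
def NoSync (a : Act) : Proc Act Key → Prop
  | nil => True
  | pre _ _ P => P.NoSync a
  | past _ _ _ P => P.NoSync a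
  | choice P Q => P.NoSync a ∧ Q.NoSync a
  | par L P Q => a ∉ L ∧ P.NoSync a ∧ Q.NoSync a

end Proc

section Semantics

variable {Act : Type u} {Key : Type v}

/-- Forward transitions: `FStep R a r i R'` stands for `R —<a,r>[i]→ R'`. -/
inductive FStep : Proc Act Key → Act → Rate → Key → Proc Act Key → Prop
  | act1 {a r i R} : R.Std → FStep (.pre a r R) a r i (.past a r i R)
  | act2 {a r i b m j R R'} : FStep R b m j R' → j ≠ i →
      FStep (.past a r i R) b m j (.past a r i R')
  | choL {a r i R R' S} : FStep R a r i R' → S.Std →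
      FStep (.choice R S) a r i (.choice R' S)
  | choR {a r i R S S'} : FStep S a r i S' → R.Std →
      FStep (.choice R S) a r i (.choice R S')
  | parL {a r i L R R' S} : FStep R a r i R' → a ∉ L → i ∉ S.keys →
      FStep (.par L R S) a r i (.par L R' S)
  | parR {a r i L R S S'} : FStep S a r i S' → a ∉ L → i ∉ R.keys →
      FStep (.par L R S) a r i (.par L R S')
  | coo {a r m i L R R' S S'} : FStep R a r i R' → FStep S a m i S' → a ∈ L →
      FStep (.par L R S) a (r * m) i (.par L R' S')

/-- Backward transitions. The action `<a,r>` is undone at the backward rate `bk a r`;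
`BStep bk R a r i R'` stands for a backward transition from `R` to `R'` that undoes `a` with
key `i`, where `r` is the backward rate that labels the transition. -/
inductive BStep (bk : Act → Rate → Rate) :
    Proc Act Key → Act → Rate → Key → Proc Act Key → Prop
  | act1 {a r i R} : R.Std → BStep bk (.past a r i R) a (bk a r) i (.pre a r R)
  | act2 {a r i b m j R R'} : BStep bk R b m j R' → j ≠ i →
      BStep bk (.past a r i R) b m j (.past a r i R')
  | choL {a r i R R' S} : BStep bk R a r i R' → S.Std →
      BStep bk (.choice R S) a r i (.choice R' S)
  | choR {a r i R S S'} : BStep bk S a r i S' → R.Std →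
      BStep bk (.choice R S) a r i (.choice R S')
  | parL {a r i L R R' S} : BStep bk R a r i R' → a ∉ L → i ∉ S.keys →
      BStep bk (.par L R S) a r i (.par L R' S)
  | parR {a r i L R S S'} : BStep bk S a r i S' → a ∉ L → i ∉ R.keys →
      BStep bk (.par L R S) a r i (.par L R S')
  | coo {a r m i L R R' S S'} : BStep bk R a r i R' → BStep bk S a m i S' → a ∈ L →
      BStep bk (.par L R S) a (r * m) i (.par L R' S')

/-- Reachable processes: those derived from a standard forward process by finitely many forward
transitions. -/
def Reachable (R : Proc Act Key) : Prop :=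
  ∃ P : Proc Act Key, P.Std ∧ Relation.ReflTransGen (fun Q Q' => ∃ a r i, FStep Q a r i Q') P R

variable (Act Key) in
/-- The set of reachable processes. -/
abbrev ReachProc : Type (max u v) := {R : Proc Act Key // Reachable R}

/-- Process contexts, with one hole. -/
inductive Ctx (Act : Type u) (Key : Type v) : Type (max u v)
  | hole : Ctx Act Key
  | past : Act → Rate → Key → Ctx Act Key → Ctx Act Key
  | choiceL : Ctx Act Key → Proc Act Key → Ctx Act Key
  | choiceR : Proc Act Key → Ctx Act Key → Ctx Act Key
  | parL : Set Act → Ctx Act Key → Proc Act Key → Ctx Act Key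
  | parR : Set Act → Proc Act Key → Ctx Act Key → Ctx Act Key

namespace Ctx

/-- Replace the hole with a process. -/
def fill : Ctx Act Key → Proc Act Key → Proc Act Key
  | hole, R => R
  | past a r i C, R => .past a r i (C.fill R)
  | choiceL C S, R => .choice (C.fill R) S
  | choiceR S C, R => .choice S (C.fill R)
  | parL L C S, R => .par L (C.fill R) S
  | parR L S C, R => .par L S (C.fill R)

/-- The keys that occur in a context. -/
def keys : Ctx Act Key → Set Key
  | hole => ∅
  | past _ _ i C => insert i C.keys
  | choiceL C S => C.keys ∪ S.keys
  | choiceR S C => S.keys ∪ C.keys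
  | parL _ C S => C.keys ∪ S.keys
  | parR _ S C => S.keys ∪ C.keys

/-- The context contains no parallel composition that synchronizes on `a`. -/
def NoSync (a : Act) : Ctx Act Key → Prop
  | hole => True
  | past _ _ _ C => C.NoSync a
  | choiceL C S => C.NoSync a ∧ S.NoSync a
  | choiceR S C => S.NoSync a ∧ C.NoSync a
  | parL L C S => a ∉ L ∧ C.NoSync a ∧ S.NoSync a
  | parR L S C => a ∉ L ∧ S.NoSync a ∧ C.NoSync a

end Ctx

/-- `SyncRename a i j P P'`: `P` is a (possibly unary) parallel composition of processes
`Cₖ[<a,rₖ>[i].Rₖ]`, all of whose synchronization sets contain `a`, with `i` and `j` not occurring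
in any `Cₖ` and `Rₖ`, and `P'` is obtained from `P` by turning the displayed `i` into `j`. -/
inductive SyncRename (a : Act) (i j : Key) : Proc Act Key → Proc Act Key → Prop
  | leaf {C : Ctx Act Key} {r R} : i ∉ C.keys → j ∉ C.keys → i ∉ R.keys → j ∉ R.keys →
      SyncRename a i j (C.fill (.past a r i R)) (C.fill (.past a r j R))
  | node {L P P' Q Q'} : a ∈ L → SyncRename a i j P P' → SyncRename a i j Q Q' →
      SyncRename a i j (.par L P Q) (.par L P' Q')

/-- The two generating clauses of equality up to keys: renaming the key of an action that is not
synchronized, and renaming the common key of synchronized actions. -/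
inductive KeyRename : Proc Act Key → Proc Act Key → Prop
  | single {C : Ctx Act Key} {a r i j R} : C.NoSync a →
      i ∉ C.keys → j ∉ C.keys → i ∉ R.keys → j ∉ R.keys →
      KeyRename (C.fill (.past a r i R)) (C.fill (.past a r j R))
  | sync {C : Ctx Act Key} {a i j L P P' Q Q'} : i ∉ C.keys → j ∉ C.keys → a ∈ L →
      SyncRename a i j P P' → SyncRename a i j Q Q' →
      KeyRename (C.fill (.par L P Q)) (C.fill (.par L P' Q'))

variable (Act Key) in
/-- Equality up to keys: the smallest equivalence relation on reachable processes that contains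
the generating clauses. -/
def keySetoid : Setoid (ReachProc Act Key) :=
  Relation.EqvGen.setoid fun R S => KeyRename R.1 S.1

variable (Act Key) in
/-- Classes of reachable processes up to keys. -/
abbrev KeyClass : Type (max u v) := Quotient (keySetoid Act Key)

/-- The key-class of a reachable process. -/
def keyClass (R : ReachProc Act Key) : KeyClass Act Key := Quotient.mk _ R

/-- Transitions between key-classes, labeled with an action and a rate: those induced by forward
transitions together with those induced by backward transitions. -/
def ClassTrans (bk : Act → Rate → Rate) (s : KeyClass Act Key) (l : Act × Rate)
    (s' : KeyClass Act Key) : Prop :=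
  (∃ R R' : ReachProc Act Key, keyClass R = s ∧ keyClass R' = s' ∧
    ∃ i, FStep R.1 l.1 l.2 i R'.1) ∨
  (∃ R R' : ReachProc Act Key, keyClass R = s ∧ keyClass R' = s' ∧
    ∃ i, BStep bk R.1 l.1 l.2 i R'.1)

/-- The states of the Markov chain underlying `R`: the key-classes that can be reached from the
class of `R` through forward and backward transitions. -/
def MState (bk : Act → Rate → Rate) (R : ReachProc Act Key) : Type (max u v) :=
  {s : KeyClass Act Key //
    Relation.ReflTransGen (fun s s' => ∃ l, ClassTrans bk s l s') (keyClass R) s}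

instance (bk : Act → Rate → Rate) (R : ReachProc Act Key) : MeasurableSpace (MState bk R) := ⊤

/-- The transitions of the Markov chain underlying `R`. -/
def MTrans (bk : Act → Rate → Rate) (R : ReachProc Act Key) (s : MState bk R) (l : Act × Rate)
    (s' : MState bk R) : Prop :=
  ClassTrans bk s.1 l s'.1

/-- The rate from `s` to `s'` in the Markov chain underlying `R`: by the race policy, the sum of
the rates of all transitions from `s` to `s'`. -/
noncomputable def mrate (bk : Act → Rate → Rate) (R : ReachProc Act Key) (s s' : MState bk R) : ℝ :=
  ∑ᶠ (l : Act × Rate) (_ : MTrans bk R s l s'), (l.2 : ℝ)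

end Semantics

end RMPC

namespace CTMC

/-! ### Detailed balance and steady states on a finite state space -/

section SteadyState

variable {S : Type u} {q : S → S → ℝ} {p π : S → ℝ}

/-! Without parallel composition, every execution of an action `(a, r)` can be undone at rate `bk a
r`, and every backward step undoes such an execution. Let `Proc.weight` be the product of `r / bk a
r` over the executed actions. One execution multiplies it by exactly this ratio, which is detailed
balance for the rates, provided that two classes are joined by at most one transition per direction.
This holds because the number of executed actions tells forward from backward steps, and the last
executed action fixes the label. Both quantities ignore the identity of keys, so they make sense on
classes.

The chain is finite: transitions preserve the underlying standard process, and keys can be renamed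
into a fixed finite set. It is strongly connected because each transition has an inverse. A maximum
principle for the ratio to the weight (`IsSteadyState.eq_const_mul`) shows that the steady state is
the normalized weight, so it is itself in detailed balance.

For reversibility, detailed balance passes from the generator to the transition function: the
functions `p s * P t s u` and `p u * P t u s` of `t` solve the same linear differential equation
with the same initial value (`semigroup_detailed_balance`). The product formula `real_path_eq` for
path probabilities then reads the same in both directions of time. -/

theorem finsum_ne_eq_sum [Fintype S] [DecidableEq S] (f : S → ℝ) (s : S) :
    ∑ᶠ (s') (_ : s' ≠ s), f s' = ∑ s', if s' ≠ s then f s' else 0 := by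
  rw [← finsum_eq_sum_of_fintype]
  refine finsum_congr fun s' => ?_
  by_cases h : s' ≠ s <;> simp [h]

theorem isSteadyState_of_detailed_balance [Finite S] (hpos : ∀ s, 0 < p s)
    (hsum : ∑ᶠ s, p s = 1) (hdb : ∀ s s', p s * q s s' = p s' * q s' s) :
    IsSteadyState q p := by
  classical
  have := Fintype.ofFinite S
  refine ⟨hpos, hsum, fun s => ?_⟩
  rw [finsum_ne_eq_sum (fun s' => q s s'), finsum_ne_eq_sum (fun s' => p s' * q s' s),
    Finset.mul_sum]
  exact Finset.sum_congr rfl fun s' _ => by split_ifs <;> simp [hdb s s']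

/-- On an irreducible finite chain with a reversible measure, every steady-state distribution is
a multiple of that measure. -/
theorem IsSteadyState.eq_const_mul [Finite S] (hq : ∀ s s', 0 ≤ q s s') (hπ : ∀ s, 0 < π s)
    (hdb : ∀ s s', π s * q s s' = π s' * q s' s)
    (hirr : ∀ s s', Relation.ReflTransGen (fun x y => 0 < q x y) s s')
    (hp : IsSteadyState q p) : ∃ c, ∀ s, p s = c * π s := by
  classical
  have := Fintype.ofFinite S
  rcases isEmpty_or_nonempty S with hS | hS
  · exact ⟨0, fun s => hS.elim s⟩
  -- Maximum principle: by detailed balance, global balance at `s` says that the terms `π s * q s k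
  -- * (p s / π s - p k / π k)` sum to zero. Where the ratio is maximal they are all nonnegative, so
  -- the maximal value spreads along every positive rate.
  obtain ⟨m, hm⟩ := Finite.exists_max fun s => p s / π s
  have key : ∀ s, p s / π s = p m / π m → ∀ s', 0 < q s s' → p s' / π s' = p m / π m := by
    intro s hs s' hss'
    by_cases hne : s' = s
    · rw [hne, hs]
    have h := hp.2.2 s
    rw [finsum_ne_eq_sum (fun s' => q s s'), finsum_ne_eq_sum (fun s' => p s' * q s' s),
      Finset.mul_sum] at h
    have h0 : ∑ k, (if k ≠ s then π s * q s k * (p s / π s - p k / π k) else 0) = 0 := by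
      rw [← sub_eq_zero, ← Finset.sum_sub_distrib] at h
      refine (Finset.sum_congr rfl fun k _ => ?_).trans h
      split_ifs with hk
      · have hs0 := (hπ s).ne'
        have hk0 := (hπ k).ne'
        have e1 : π s * q s k * (p s / π s) = p s * q s k := by field_simp
        have e2 : π s * q s k * (p k / π k) = p k * q k s := by
          rw [hdb s k]; field_simp
        rw [mul_sub, e1, e2]
      · simp
    have h1 := (Finset.sum_eq_zero_iff_of_nonneg (fun k _ => by
      split_ifs
      · exact mul_nonneg (mul_nonneg (hπ s).le (hq s k)) (by rw [hs]; linarith [hm k])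
      · exact le_rfl)).1 h0 s' (Finset.mem_univ _)
    rw [if_pos hne] at h1
    have h2 := (mul_eq_zero.1 h1).resolve_left (mul_pos (hπ s) hss').ne'
    linarith
  refine ⟨p m / π m, fun s => ?_⟩
  have : p s / π s = p m / π m := by
    induction hirr m s with
    | refl => rfl
    | tail _ hbc ih => exact key _ ih _ hbc
  rw [← this, div_mul_cancel₀ _ (hπ s).ne']

theorem IsSteadyState.detailed_balance [Finite S] (hq : ∀ s s', 0 ≤ q s s') (hπ : ∀ s, 0 < π s)
    (hdb : ∀ s s', π s * q s s' = π s' * q s' s)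
    (hirr : ∀ s s', Relation.ReflTransGen (fun x y => 0 < q x y) s s')
    (hp : IsSteadyState q p) (s s' : S) : p s * q s s' = p s' * q s' s := by
  obtain ⟨c, hc⟩ := hp.eq_const_mul hq hπ hdb hirr
  rw [hc, hc, mul_assoc, mul_assoc, hdb]

theorem existsUnique_isSteadyState [Finite S] [Nonempty S] (hq : ∀ s s', 0 ≤ q s s')
    (hπ : ∀ s, 0 < π s) (hdb : ∀ s s', π s * q s s' = π s' * q s' s)
    (hirr : ∀ s s', Relation.ReflTransGen (fun x y => 0 < q x y) s s') :
    ∃! p, IsSteadyState q p := by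
  have := Fintype.ofFinite S
  have hZ : 0 < ∑ s, π s := Finset.sum_pos (fun s _ => hπ s) Finset.univ_nonempty
  refine ⟨fun s => π s / ∑ k, π k, isSteadyState_of_detailed_balance
    (fun s => div_pos (hπ s) hZ) ?_ fun s s' => ?_, fun p hp => ?_⟩
  · rw [finsum_eq_sum_of_fintype, ← Finset.sum_div, div_self hZ.ne']
  · rw [div_mul_eq_mul_div, div_mul_eq_mul_div, hdb]
  · obtain ⟨c, hc⟩ := hp.eq_const_mul hq hπ hdb hirr
    have h1 := hp.2.1
    rw [finsum_eq_sum_of_fintype, Finset.sum_congr rfl fun s _ => hc s, ← Finset.mul_sum] at h1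
    funext s
    rw [hc, eq_div_iff hZ.ne', mul_right_comm, h1, one_mul]

end SteadyState

/-! ### Transition semigroups -/

section Semigroup

variable {S : Type u} [Fintype S] {P : ℝ → S → S → ℝ} {G : S → S → ℝ} {p : S → ℝ}

/-- The forward equation, with right derivatives. -/
theorem hasDerivWithinAt_forward
    (hP : ∀ t h, 0 ≤ t → 0 ≤ h → ∀ s u, P (t + h) s u = ∑ k, P t s k * P h k u)
    (hG : ∀ s u, HasDerivWithinAt (fun h => P h s u) (G s u) (Set.Ici 0) 0)
    {t : ℝ} (ht : 0 ≤ t) (s u : S) :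
    HasDerivWithinAt (fun y => P y s u) (∑ k, P t s k * G k u) (Set.Ici t) t := by
  have h1 : ∀ k, HasDerivWithinAt (fun y => P (y - t) k u) (G k u) (Set.Ici t) t := fun k => by
    have h2 : HasDerivWithinAt (fun y : ℝ => y - t) 1 (Set.Ici t) t :=
      (hasDerivWithinAt_id t _).sub_const t
    have h3 : HasDerivWithinAt (fun h => P h k u) (G k u) (Set.Ici 0) (t - t) := by
      rw [sub_self]; exact hG k u
    simpa [Function.comp_def] using HasDerivWithinAt.comp (h₂ := fun h => P h k u)
      (h := fun y => y - t) t h3 h2 fun y hy => Set.mem_Ici.2 (sub_nonneg.2 hy)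
  refine (HasDerivWithinAt.fun_sum (u := Finset.univ) fun k _ =>
    (h1 k).const_mul (P t s k)).congr (fun y hy => ?_) ?_
  · rw [← hP t (y - t) ht (sub_nonneg.2 hy), add_sub_cancel]
  · rw [← hP t (t - t) ht (sub_self t).ge, add_sub_cancel]

/-- The backward equation, with right derivatives. -/
theorem hasDerivWithinAt_backward
    (hP : ∀ t h, 0 ≤ t → 0 ≤ h → ∀ s u, P (t + h) s u = ∑ k, P t s k * P h k u)
    (hG : ∀ s u, HasDerivWithinAt (fun h => P h s u) (G s u) (Set.Ici 0) 0)
    {t : ℝ} (ht : 0 ≤ t) (s u : S) :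
    HasDerivWithinAt (fun y => P y s u) (∑ k, G s k * P t k u) (Set.Ici t) t := by
  -- The transposed family is again a semigroup, because addition of times commutes; its forward
  -- equation is the backward equation.
  have := hasDerivWithinAt_forward (P := fun t s u => P t u s) (G := fun s u => G u s)
    (fun t h ht hh s u => by
      rw [add_comm, hP h t hh ht u s]
      exact Finset.sum_congr rfl fun _ _ => mul_comm _ _) (fun s u => hG u s) ht u s
  simpa only [mul_comm] using this

/-- Uniqueness for the differential equation needs two-sided continuity, while the generator only
gives right continuity at `0`. Since `P y - P x = P x * (P (y - x) - P 0)` and the entries of `P x`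
are bounded by `1`, the modulus of continuity at `0` works at every time. -/
theorem continuousOn_semigroup (hb : ∀ t, 0 ≤ t → ∀ s u, |P t s u| ≤ 1)
    (hP : ∀ t h, 0 ≤ t → 0 ≤ h → ∀ s u, P (t + h) s u = ∑ k, P t s k * P h k u)
    (hG : ∀ s u, HasDerivWithinAt (fun h => P h s u) (G s u) (Set.Ici 0) 0) (s u : S) :
    ContinuousOn (fun t => P t s u) (Set.Ici 0) := by
  have hε : ContinuousWithinAt (fun h => ∑ k, |P h k u - P 0 k u|) (Set.Ici 0) 0 :=
    tendsto_finsetSum _ fun k _ =>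
      (((hG k u).continuousWithinAt).sub continuousWithinAt_const).abs
  have hd : ∀ x y, 0 ≤ x → x ≤ y → |P y s u - P x s u| ≤ ∑ k, |P (y - x) k u - P 0 k u| := by
    intro x y hx hxy
    have e : P y s u - P x s u = ∑ k, P x s k * (P (y - x) k u - P 0 k u) := by
      simp_rw [mul_sub, Finset.sum_sub_distrib, ← hP x _ hx (sub_nonneg.2 hxy),
        ← hP x 0 hx le_rfl]
      simp
    rw [e]
    refine (Finset.abs_sum_le_sum_abs _ _).trans (Finset.sum_le_sum fun k _ => ?_)
    rw [abs_mul]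
    exact mul_le_of_le_one_left (abs_nonneg _) (hb x hx s k)
  rw [Metric.continuousOn_iff]
  intro x hx ε hε0
  obtain ⟨δ, hδ0, hδ⟩ := Metric.continuousWithinAt_iff.1 hε ε hε0
  refine ⟨δ, hδ0, fun y hy hxy => ?_⟩
  have hlt : ∀ h : ℝ, 0 ≤ h → h < δ → ∑ k, |P h k u - P 0 k u| < ε := fun h hh hhδ => by
    have := hδ hh (by simpa [abs_of_nonneg hh] using hhδ)
    rw [Real.dist_eq] at this
    simpa using (le_abs_self _).trans_lt this
  rw [Real.dist_eq] at hxy ⊢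
  rcases le_total x y with h | h
  · exact (hd x y hx h).trans_lt (hlt _ (sub_nonneg.2 h) ((le_abs_self _).trans_lt hxy))
  · rw [abs_sub_comm] at hxy ⊢
    exact (hd y x hy h).trans_lt (hlt _ (sub_nonneg.2 h) ((le_abs_self _).trans_lt hxy))

/-- If the generator of a semigroup is in detailed balance with `p`, then so is the semigroup. -/
theorem semigroup_detailed_balance [DecidableEq S] (hb : ∀ t, 0 ≤ t → ∀ s u, |P t s u| ≤ 1)
    (h0 : ∀ s u, P 0 s u = if s = u then 1 else 0)
    (hP : ∀ t h, 0 ≤ t → 0 ≤ h → ∀ s u, P (t + h) s u = ∑ k, P t s k * P h k u)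
    (hG : ∀ s u, HasDerivWithinAt (fun h => P h s u) (G s u) (Set.Ici 0) 0)
    (hdb : ∀ s u, p s * G s u = p u * G u s) {t : ℝ} (ht : 0 ≤ t) (s u : S) :
    p s * P t s u = p u * P t u s := by
  let L : (S → ℝ) →L[ℝ] (S → ℝ) :=
    LinearMap.toContinuousLinearMap (Matrix.vecMulLinear (Matrix.of G))
  have hL : ∀ x u, L x u = ∑ k, x k * G k u := fun x u => rfl
  have hc := continuousOn_semigroup hb hP hG
  -- Both sides, as row vectors indexed by `u`, solve `x' = x G`: the left one by the forward
  -- equation, the right one by the backward equation with detailed balance of `G`.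
  have h := ODE_solution_unique_of_mem_Icc_right (v := fun _ => L) (s := fun _ => Set.univ)
    (f := fun t u => p s * P t s u) (g := fun t u => p u * P t u s) (a := 0) (b := t)
    (K := ‖L‖₊) (fun _ _ => L.lipschitz.lipschitzOnWith)
    (continuousOn_pi.2 fun u => continuousOn_const.mul ((hc s u).mono Set.Icc_subset_Ici_self))
    (fun x hx => hasDerivWithinAt_pi.2 fun u => by
      rw [hL]
      simp_rw [mul_assoc, ← Finset.mul_sum]
      exact (hasDerivWithinAt_forward hP hG hx.1 s u).const_mul _)
    (fun _ _ => Set.mem_univ _)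
    (continuousOn_pi.2 fun u => continuousOn_const.mul ((hc u s).mono Set.Icc_subset_Ici_self))
    (fun x hx => hasDerivWithinAt_pi.2 fun u => by
      have e : L (fun u => p u * P x u s) u = p u * ∑ k, G u k * P x k s := by
        rw [hL, Finset.mul_sum]
        refine Finset.sum_congr rfl fun k _ => ?_
        rw [mul_right_comm, hdb k u, mul_assoc]
      rw [e]
      exact (hasDerivWithinAt_backward hP hG hx.1 u s).const_mul _)
    (fun _ _ => Set.mem_univ _)
    (by
      funext u
      rcases eq_or_ne s u with rfl | hsu
      · rfl
      · simp [h0, hsu, hsu.symm])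
  exact congrFun (h (Set.right_mem_Icc.2 ht)) u

end Semigroup

end CTMC

namespace CTMC

/-! ### Finite Markov chains in equilibrium -/

section Chain

variable {Ω : Type w} {S : Type u} [MeasurableSpace Ω]
  {μ : Measure Ω} {X : ℝ≥0 → Ω → S} {q : S → S → ℝ} {p : S → ℝ}

/-- The transition function `Pr(X h = s' | X 0 = s)`. -/
noncomputable def transition (μ : Measure Ω) (X : ℝ≥0 → Ω → S) (h : ℝ≥0) (s s' : S) : ℝ :=
  (cond μ {ω | X 0 ω = s}).real {ω | X h ω = s'}

theorem transition_nonneg (h : ℝ≥0) (s s' : S) : 0 ≤ transition μ X h s s' :=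
  measureReal_nonneg

theorem transition_le_one (h : ℝ≥0) (s s' : S) : transition μ X h s s' ≤ 1 :=
  measureReal_le_one

/-- The factor `p` travels along the path from its first to its last state, and flips each
transition that it passes. -/
theorem prod_transition_reverse {n : ℕ} {P : Fin n → S → S → ℝ}
    (hP : ∀ i s u, p s * P i s u = p u * P i u s) (s : Fin (n + 1) → S) :
    p (s 0) * ∏ i : Fin n, P i (s i.castSucc) (s i.succ) =
      p (s (Fin.last n)) * ∏ i : Fin n, P i (s i.succ) (s i.castSucc) := by
  induction n with
  | zero => simp
  | succ n ih =>
    have := ih (fun i => hP i.castSucc) fun i => s i.castSucc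
    simp only [Fin.castSucc_zero] at this
    rw [Fin.prod_univ_castSucc, Fin.prod_univ_castSucc, ← mul_assoc]
    simp only [Fin.succ_castSucc, Fin.succ_last]
    rw [this, mul_right_comm, hP]
    ring

variable [MeasurableSpace S] [MeasurableSingletonClass S]

theorem IsMarkovChain.measurableSet_eq (hX : IsMarkovChain μ X) (t : ℝ≥0) (s : S) :
    MeasurableSet {ω | X t ω = s} :=
  hX.measurable t (measurableSet_singleton s)

theorem IsMarkovChain.measurableSet_path (hX : IsMarkovChain μ X) {n : ℕ} (t : Fin n → ℝ≥0)
    (s : Fin n → S) : MeasurableSet {ω | ∀ i, X (t i) ω = s i} := by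
  rw [Set.ofPred_forall]
  exact MeasurableSet.iInter fun i => hX.measurableSet_eq _ _

/-- Summing over the values of one observation. -/
theorem IsMarkovChain.sum_real_inter [Fintype S] [IsFiniteMeasure μ] (hX : IsMarkovChain μ X)
    (t : ℝ≥0) (A : Set Ω) : ∑ s, μ.real (A ∩ {ω | X t ω = s}) = μ.real A := by
  have h := sum_measureReal_preimage_singleton (μ := μ.restrict A) (f := X t) Finset.univ
    fun s _ => hX.measurableSet_eq t s
  simp only [Finset.coe_univ, Set.preimage_univ, measureReal_restrict_apply_univ] at h
  rw [← h]
  refine Finset.sum_congr rfl fun s _ => ?_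
  rw [measureReal_restrict_apply (hX.measurable t (measurableSet_singleton s)), Set.inter_comm]
  rfl

/-- The multiplied form also covers null events `A`, where both sides vanish. -/
theorem real_cond_mul [IsFiniteMeasure μ] {A : Set Ω} (hA : MeasurableSet A) (B : Set Ω) :
    μ.real A * (cond μ A).real B = μ.real (A ∩ B) := by
  rw [measureReal_def, measureReal_def, measureReal_def, ← cond_mul_eq_inter hA,
    ENNReal.toReal_mul, mul_comm]

variable [IsProbabilityMeasure μ]

/-- All states have positive mass at time `0`, so time `0` can serve as the reference in
`IsTimeHomogeneous` for every state. -/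
theorem real_inter_eq_mul_transition (hX : IsMarkovChain μ X) (hH : IsTimeHomogeneous μ X)
    (h0 : ∀ s, μ {ω | X 0 ω = s} ≠ 0) (t h : ℝ≥0) (s s' : S) :
    μ.real ({ω | X t ω = s} ∩ {ω | X (t + h) ω = s'}) =
      μ.real {ω | X t ω = s} * transition μ X h s s' := by
  rw [← real_cond_mul (hX.measurableSet_eq t s)]
  by_cases hz : μ {ω | X t ω = s} = 0
  · simp [measureReal_def, hz]
  · rw [measureReal_def (cond μ _), hH t 0 h s s' hz (h0 s), zero_add]
    rfl

/-- The finite-dimensional distributions of a time-homogeneous Markov chain. -/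
theorem real_path_eq (hX : IsMarkovChain μ X) (hH : IsTimeHomogeneous μ X)
    (h0 : ∀ s, μ {ω | X 0 ω = s} ≠ 0) :
    ∀ (n : ℕ) (t : Fin (n + 1) → ℝ≥0), StrictMono t → ∀ s : Fin (n + 1) → S,
      μ.real {ω | ∀ i, X (t i) ω = s i} = μ.real {ω | X (t 0) ω = s 0} *
        ∏ i : Fin n, transition μ X (t i.succ - t i.castSucc) (s i.castSucc) (s i.succ) := by
  intro n
  induction n with
  | zero =>
    intro t _ s
    simp
  | succ n ih =>
    intro t ht s
    rw [Fin.prod_univ_castSucc, ← mul_assoc]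
    have ih' := ih (fun i => t i.castSucc) (fun i j hij => ht (Fin.castSucc_lt_castSucc_iff.2 hij))
      (fun i => s i.castSucc)
    simp only [Fin.castSucc_zero] at ih'
    simp only [Fin.succ_castSucc, ← ih', Fin.succ_last]
    have hset : {ω | ∀ i, X (t i) ω = s i} = {ω | ∀ i : Fin (n + 1), X (t i.castSucc) ω =
        s i.castSucc} ∩ {ω | X (t (Fin.last (n + 1))) ω = s (Fin.last (n + 1))} := by
      ext ω
      simp [Fin.forall_fin_succ']
    rw [hset, ← real_cond_mul (hX.measurableSet_path _ _)]
    by_cases hz : μ {ω | ∀ i : Fin (n + 1), X (t i.castSucc) ω = s i.castSucc} = 0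
    · simp [measureReal_def, hz]
    · have hz' : μ {ω | X (t (Fin.last n).castSucc) ω = s (Fin.last n).castSucc} ≠ 0 :=
        fun h => hz (measure_mono_null (fun ω hω => hω (Fin.last n)) h)
      have hle : t (Fin.last n).castSucc ≤ t (Fin.last (n + 1)) := ht.monotone (Fin.le_last _)
      have := hH (t (Fin.last n).castSucc) 0 (t (Fin.last (n + 1)) - t (Fin.last n).castSucc)
        (s (Fin.last n).castSucc) (s (Fin.last (n + 1))) hz' (h0 _)
      rw [add_tsub_cancel_of_le hle, zero_add] at this
      rw [measureReal_def (cond μ _), hX.markov n t ht s hz, this]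
      rfl

theorem transition_zero [DecidableEq S] (hX : IsMarkovChain μ X)
    (h0 : ∀ s, μ {ω | X 0 ω = s} ≠ 0) (s s' : S) :
    transition μ X 0 s s' = if s = s' then 1 else 0 := by
  rw [transition, measureReal_def, cond_apply (hX.measurableSet_eq 0 s)]
  split_ifs with h
  · rw [← h, Set.inter_self, ENNReal.inv_mul_cancel (h0 s) (measure_ne_top _ _), ENNReal.toReal_one]
  · have : {ω | X 0 ω = s} ∩ {ω | X 0 ω = s'} = ∅ := by
      ext ω
      simp only [Set.mem_inter_iff, Set.mem_ofPred_eq, Set.mem_empty_iff_false, iff_false]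
      rintro ⟨h1, h2⟩
      exact h (h1.symm.trans h2)
    simp [this]

theorem sum_transition [Fintype S] (hX : IsMarkovChain μ X)
    (h0 : ∀ s, μ {ω | X 0 ω = s} ≠ 0) (h : ℝ≥0) (s : S) :
    ∑ s', transition μ X h s s' = 1 := by
  have hpos : μ.real {ω | X 0 ω = s} ≠ 0 := by
    rw [measureReal_def]
    exact (ENNReal.toReal_pos (h0 s) (measure_ne_top _ _)).ne'
  refine mul_left_cancel₀ hpos ?_
  rw [Finset.mul_sum, mul_one]
  simp_rw [transition, real_cond_mul (hX.measurableSet_eq 0 s)]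
  exact hX.sum_real_inter h _

/-- The Chapman–Kolmogorov equations. -/
theorem transition_add [Fintype S] (hX : IsMarkovChain μ X) (hH : IsTimeHomogeneous μ X)
    (h0 : ∀ s, μ {ω | X 0 ω = s} ≠ 0) (t h : ℝ≥0) (s u : S) :
    transition μ X (t + h) s u = ∑ k, transition μ X t s k * transition μ X h k u := by
  classical
  -- The path formula needs strictly increasing times `0 < t < t + h`, so the degenerate cases are
  -- treated apart.
  rcases eq_or_ne t 0 with rfl | ht
  · simp [transition_zero hX h0]
  rcases eq_or_ne h 0 with rfl | hh
  · simp [transition_zero hX h0]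
  have hpos : μ.real {ω | X 0 ω = s} ≠ 0 := by
    rw [measureReal_def]
    exact (ENNReal.toReal_pos (h0 s) (measure_ne_top _ _)).ne'
  refine mul_left_cancel₀ hpos ?_
  rw [transition, real_cond_mul (hX.measurableSet_eq 0 s), ← hX.sum_real_inter t, Finset.mul_sum]
  refine Finset.sum_congr rfl fun k _ => ?_
  have hmono : StrictMono ![0, t, t + h] := by
    rw [Fin.strictMono_iff_lt_succ]
    intro i
    fin_cases i
    · exact pos_iff_ne_zero.2 ht
    · exact lt_add_of_pos_right t (pos_iff_ne_zero.2 hh)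
  have := real_path_eq hX hH h0 2 ![0, t, t + h] hmono ![s, k, u]
  simp only [Fin.forall_fin_succ, Fin.prod_univ_two] at this
  simp only [Fin.isValue, Matrix.cons_val_zero, Matrix.cons_val_succ, IsEmpty.forall_iff,
    and_true, Fin.succ_zero_eq_one, Fin.castSucc_zero, Fin.succ_one_eq_two, Fin.castSucc_one,
    Matrix.cons_val_one, Matrix.cons_val, tsub_zero, add_tsub_cancel_left] at this
  rw [← this]
  congr 1
  ext ω
  simp only [Set.mem_inter_iff, Set.mem_ofPred_eq]
  tauto

/-- The generator of the chain with rates `q`. -/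
noncomputable def generator [Fintype S] [DecidableEq S] (q : S → S → ℝ) (s s' : S) : ℝ :=
  if s = s' then -∑ k ∈ Finset.univ.erase s, q s k else q s s'

/-- Off the diagonal this is `HasRates` at time `0`; the diagonal entry follows because the rows sum
to `1`. -/
theorem hasDerivWithinAt_transition [Fintype S] [DecidableEq S] (hX : IsMarkovChain μ X)
    (hq : HasRates μ X q) (h0 : ∀ s, μ {ω | X 0 ω = s} ≠ 0) (s u : S) :
    HasDerivWithinAt (fun h : ℝ => transition μ X h.toNNReal s u) (generator q s u)
      (Set.Ici 0) 0 := by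
  have hne : ∀ k, s ≠ k →
      HasDerivWithinAt (fun h : ℝ => transition μ X h.toNNReal s k) (q s k) (Set.Ici 0) 0 := by
    intro k hk
    rw [← hasDerivWithinAt_Ioi_iff_Ici, hasDerivWithinAt_iff_tendsto_slope' (by simp)]
    have h1 := hq 0 s k hk (h0 s)
    have h2 : Tendsto (fun h : ℝ => h.toNNReal) (𝓝[>] 0) (𝓝[>] 0) := by
      rw [← NNReal.coe_zero, ← NNReal.map_coe_nhdsGT, tendsto_map'_iff]
      simp only [Function.comp_def, Real.toNNReal_coe]
      exact tendsto_id
    refine (h1.comp h2).congr' ?_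
    filter_upwards [self_mem_nhdsWithin] with h hh
    have hh' : (0 : ℝ) < h := hh
    simp only [Function.comp_apply, slope_def_field, Real.toNNReal_zero,
      transition_zero hX h0, if_neg hk, sub_zero, zero_add, Real.coe_toNNReal h hh'.le]
    rfl
  rw [generator]
  split_ifs with h
  · subst h
    have e : (fun h : ℝ => transition μ X h.toNNReal s s) =
        fun h : ℝ => 1 - ∑ k ∈ Finset.univ.erase s, transition μ X h.toNNReal s k := by
      funext h
      rw [← sum_transition hX h0 h.toNNReal s,
        ← Finset.add_sum_erase _ _ (Finset.mem_univ s), add_sub_cancel_right]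
    rw [e]
    exact (HasDerivWithinAt.fun_sum fun k hk => hne k (Finset.ne_of_mem_erase hk).symm).const_sub 1
  · exact hne u h

theorem transition_detailed_balance [Finite S] (hX : IsMarkovChain μ X)
    (hH : IsTimeHomogeneous μ X) (hq : HasRates μ X q) (h0 : ∀ s, μ {ω | X 0 ω = s} ≠ 0)
    (hdb : ∀ s u, p s * q s u = p u * q u s) (t : ℝ≥0) (s u : S) :
    p s * transition μ X t s u = p u * transition μ X t u s := by
  classical
  have := Fintype.ofFinite S
  have := semigroup_detailed_balance (P := fun t s u => transition μ X t.toNNReal s u)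
    (G := generator q) (p := p)
    (fun t _ s u => by
      rw [abs_of_nonneg (transition_nonneg _ _ _)]; exact transition_le_one _ _ _)
    (fun s u => by simp only [Real.toNNReal_zero]; exact transition_zero hX h0 s u)
    (fun t h ht hh s u => by
      simp only [Real.toNNReal_add ht hh]; exact transition_add hX hH h0 _ _ s u)
    (hasDerivWithinAt_transition hX hq h0)
    (fun s u => by
      rcases eq_or_ne s u with rfl | h
      · rfl
      · rw [generator, generator, if_neg h, if_neg h.symm, hdb])
    t.coe_nonneg s u
  simpa using this

theorem identDistrib_of_real_eq [Finite S] (hX : IsMarkovChain μ X) {n : ℕ}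
    {t t' : Fin n → ℝ≥0}
    (h : ∀ s : Fin n → S, μ.real {ω | ∀ i, X (t i) ω = s i} = μ.real {ω | ∀ i, X (t' i) ω = s i}) :
    IdentDistrib (fun ω i => X (t i) ω) (fun ω i => X (t' i) ω) μ μ := by
  have hm : ∀ t : Fin n → ℝ≥0, Measurable fun ω i => X (t i) ω :=
    fun t => measurable_pi_lambda _ fun i => hX.measurable _
  refine ⟨(hm t).aemeasurable, (hm t').aemeasurable, Measure.ext_of_singleton fun s => ?_⟩
  rw [Measure.map_apply (hm t) (measurableSet_singleton s),
    Measure.map_apply (hm t') (measurableSet_singleton s)]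
  have e : ∀ t : Fin n → ℝ≥0,
      (fun ω i => X (t i) ω) ⁻¹' {s} = {ω | ∀ i, X (t i) ω = s i} := fun t => by
    ext ω
    simp [funext_iff]
  rw [e, e]
  exact (ENNReal.toReal_eq_toReal_iff' (measure_ne_top _ _) (measure_ne_top _ _)).1 (h s)

/-- A finite time-homogeneous Markov chain started from a strictly positive distribution that is
in detailed balance with its rates is stationary and time reversible. -/
theorem stationary_and_timeReversible [Finite S] (hp : ∀ s, 0 < p s)
    (hdb : ∀ s u, p s * q s u = p u * q u s) (hX : IsMarkovChain μ X)
    (hH : IsTimeHomogeneous μ X) (hq : HasRates μ X q)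
    (hinit : ∀ s, μ.real {ω | X 0 ω = s} = p s) :
    IsStationary μ X ∧ IsTimeReversible μ X := by
  have := Fintype.ofFinite S
  have h0 : ∀ s, μ {ω | X 0 ω = s} ≠ 0 := fun s h => by
    have := hinit s
    rw [measureReal_def, h, ENNReal.toReal_zero] at this
    exact (hp s).ne this
  have hT := transition_detailed_balance hX hH hq h0 hdb
  -- Detailed balance turns the sum over the initial states `k` into `p s` times a row sum, which is
  -- `1`.
  have hlaw : ∀ t s, μ.real {ω | X t ω = s} = p s := fun t s => by
    rw [← hX.sum_real_inter 0]
    calc _ = ∑ k, p s * transition μ X t s k := Finset.sum_congr rfl fun k _ => by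
            have := real_inter_eq_mul_transition hX hH h0 0 t k s
            rw [zero_add, hinit, hT] at this
            rw [Set.inter_comm, this]
      _ = p s := by rw [← Finset.mul_sum, sum_transition hX h0, mul_one]
  have hpath := real_path_eq hX hH h0
  refine ⟨fun n t ht t' => ?_, fun n t ht t' ht' => ?_⟩
  · refine identDistrib_of_real_eq (t := fun i => t i + t') hX fun s => ?_
    cases n with
    | zero => simp
    | succ n =>
      rw [hpath n (fun i => t i + t') (fun i j hij => add_lt_add_left (ht hij) _), hpath n t ht,
        hlaw, hlaw]
      simp only [add_tsub_add_eq_tsub_right]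
  · refine identDistrib_of_real_eq (t' := fun i => t' - t i) hX fun s => ?_
    cases n with
    | zero => simp
    | succ n =>
      -- The reversed times decrease, so indices are reflected by `Fin.rev` before the path formula
      -- is applied.
      have hrev : {ω | ∀ i, X (t' - t i) ω = s i} =
          {ω | ∀ i : Fin (n + 1), X (t' - t i.rev) ω = s i.rev} := by
        ext ω
        exact ⟨fun h i => h _, fun h i => by simpa using h i.rev⟩
      have hmono : StrictMono fun i : Fin (n + 1) => t' - t i.rev := fun i j hij =>
        tsub_lt_tsub_left_of_le (ht' _) (ht (Fin.rev_lt_rev.2 hij))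
      rw [hrev, hpath n t ht, hpath n _ hmono fun i => s i.rev, hlaw, hlaw,
        prod_transition_reverse (P := fun i => transition μ X (t i.succ - t i.castSucc))
          (fun i => hT _), Fin.rev_zero]
      congr 1
      refine Fintype.prod_equiv Fin.revPerm _ _ fun i => ?_
      simp only [Fin.revPerm_apply, Fin.rev_castSucc, Fin.rev_succ, Fin.rev_rev]
      congr 1
      rw [tsub_tsub_tsub_cancel_left (ht' _)]

end Chain

end CTMC

namespace RMPC

/-! ### Invariants of processes -/

namespace Proc

variable {Act : Type u} {Key : Type v} {Key' : Type w}

/-- Apply a function to all keys. -/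
def map (f : Key → Key') : Proc Act Key → Proc Act Key'
  | nil => nil
  | pre a r P => pre a r (P.map f)
  | past a r i P => past a r (f i) (P.map f)
  | choice P Q => choice (P.map f) (Q.map f)
  | par L P Q => par L (P.map f) (Q.map f)

/-- Forget the identity of the keys, but not which prefixes carry one. -/
def erase (P : Proc Act Key) : Proc Act Unit := P.map fun _ => ()

/-- The standard process obtained by removing all keys. -/
def shape : Proc Act Key → Proc Act Unit
  | nil => nil
  | pre a r P => pre a r P.shape
  | past a r _ P => pre a r P.shape
  | choice P Q => choice P.shape Q.shape
  | par L P Q => par L P.shape Q.shape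

/-- The number of prefixes. -/
def size : Proc Act Key → ℕ
  | nil => 0
  | pre _ _ P => P.size + 1
  | past _ _ _ P => P.size + 1
  | choice P Q => P.size + Q.size
  | par _ P Q => P.size + Q.size

/-- The number of prefixes that carry a key. -/
def pastCount : Proc Act Key → ℕ
  | nil => 0
  | pre _ _ P => P.pastCount
  | past _ _ _ P => P.pastCount + 1
  | choice P Q => P.pastCount + Q.pastCount
  | par _ P Q => P.pastCount + Q.pastCount

/-- The last executed action of a sequential process. -/
def last : Proc Act Key → Option (Act × Rate)
  | nil => none
  | pre _ _ _ => none
  -- Executed actions below the prefix are more recent; the prefix itself is the default when there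
  -- are none.
  | past a r _ P => some (P.last.getD (a, r))
  | choice P Q => P.last.or Q.last
  | par _ _ _ => none

/-- The product of the ratios of forward and backward rates over the executed actions. -/
noncomputable def weight (bk : Act → Rate → Rate) : Proc Act Key → ℝ
  | nil => 1
  | pre _ _ P => P.weight bk
  | past a r _ P => (r : ℝ) / (bk a r : ℝ) * P.weight bk
  | choice P Q => P.weight bk * Q.weight bk
  | par _ P Q => P.weight bk * Q.weight bk

/-- No key occurs below a prefix that carries the same key, only one side of a choice carries
keys, and no key occurs below a prefix without key. -/
def KeysDistinct : Proc Act Key → Prop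
  | nil => True
  | pre _ _ P => P.Std
  | past _ _ i P => i ∉ P.keys ∧ P.KeysDistinct
  | choice P Q => P.KeysDistinct ∧ Q.KeysDistinct ∧ (P.Std ∨ Q.Std)
  -- Nothing is demanded here: the predicate is only exploited for processes without parallel
  -- composition.
  | par _ _ _ => True

theorem weight_pos (bk : Act → Rate → Rate) (P : Proc Act Key) : 0 < P.weight bk := by
  induction P with
  | nil => exact one_pos
  | pre _ _ _ ih => exact ih
  | past a r _ _ ih => exact mul_pos (div_pos r.2 (bk a r).2) ih
  | choice _ _ ih ih' => exact mul_pos ih ih'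
  | par _ _ _ ih ih' => exact mul_pos ih ih'

theorem erase_parFree (P : Proc Act Key) : P.erase.ParFree ↔ P.ParFree := by
  unfold erase
  induction P <;> simp_all [map, ParFree]

theorem erase_shape (P : Proc Act Key) : P.erase.shape = P.shape := by
  unfold erase
  induction P <;> simp_all [map, shape]

theorem shape_size (P : Proc Act Key) : P.shape.size = P.size := by
  induction P <;> simp_all [shape, size]

theorem erase_pastCount (P : Proc Act Key) : P.erase.pastCount = P.pastCount := by
  unfold erase
  induction P <;> simp_all [map, pastCount]

theorem erase_last (P : Proc Act Key) : P.erase.last = P.last := by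
  unfold erase
  induction P <;> simp_all [map, last]

theorem erase_weight (bk : Act → Rate → Rate) (P : Proc Act Key) :
    P.erase.weight bk = P.weight bk := by
  unfold erase
  induction P <;> simp_all [map, weight]

theorem keys_map (f : Key → Key') (P : Proc Act Key) : (P.map f).keys = f '' P.keys := by
  induction P <;> simp_all [map, keys, Set.image_union, Set.image_insert_eq]

theorem Std.map {P : Proc Act Key} (h : P.Std) (f : Key → Key') : (P.map f).Std := by
  induction P <;> simp_all [Proc.map, Std]

theorem Std.keys_eq_empty {P : Proc Act Key} (h : P.Std) : P.keys = ∅ := by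
  induction P <;> simp_all [keys, Std]

theorem Std.last_eq_none {P : Proc Act Key} (h : P.Std) : P.last = none := by
  induction P <;> simp_all [last, Std]

theorem Std.keysDistinct {P : Proc Act Key} (h : P.Std) : P.KeysDistinct := by
  induction P <;> simp_all [KeysDistinct, Std]

theorem ParFree.noSync {P : Proc Act Key} (h : P.ParFree) (a : Act) : P.NoSync a := by
  induction P <;> simp_all [ParFree, NoSync]

theorem map_congr {f g : Key → Key'} {P : Proc Act Key} (h : ∀ k ∈ P.keys, f k = g k) :
    P.map f = P.map g := by
  induction P with
  | nil => rfl
  | pre _ _ _ ih => simp only [map, ih h]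
  | past _ _ _ _ ih =>
    simp only [map, ih fun k hk => h k (Set.mem_insert_of_mem _ hk), h _ (Set.mem_insert _ _)]
  | choice _ _ ih ih' =>
    simp only [map, ih fun k hk => h k (Or.inl hk), ih' fun k hk => h k (Or.inr hk)]
  | par _ _ _ ih ih' =>
    simp only [map, ih fun k hk => h k (Or.inl hk), ih' fun k hk => h k (Or.inr hk)]

theorem map_id (P : Proc Act Key) : P.map id = P := by
  induction P <;> simp_all [map]

theorem map_swap_eq_self [DecidableEq Key] {i j : Key} {P : Proc Act Key} (hi : i ∉ P.keys)
    (hj : j ∉ P.keys) : P.map (Equiv.swap i j) = P := by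
  conv_rhs => rw [← P.map_id]
  exact map_congr fun k hk => Equiv.swap_apply_of_ne_of_ne (fun h => hi (h ▸ hk))
    fun h => hj (h ▸ hk)

theorem finite_keys (P : Proc Act Key) : P.keys.Finite := by
  induction P <;> simp_all [keys]

theorem ncard_keys_le_size (P : Proc Act Key) : P.keys.ncard ≤ P.size := by
  induction P with
  | nil => simp [keys]
  | pre _ _ _ ih => exact ih.trans (Nat.le_succ _)
  | past _ _ _ _ ih => exact (Set.ncard_insert_le _ _).trans (Nat.succ_le_succ ih)
  | choice _ _ ih ih' => exact (Set.ncard_union_le _ _).trans (add_le_add ih ih')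
  | par _ _ _ ih ih' => exact (Set.ncard_union_le _ _).trans (add_le_add ih ih')

/-- A term over a given shape is determined by assigning to each prefix either no key or an element
of `K`. -/
theorem finite_shape_eq {K : Set Key} (hK : K.Finite) (P : Proc Act Unit) :
    {Q : Proc Act Key | Q.shape = P ∧ Q.keys ⊆ K}.Finite := by
  induction P with
  | nil =>
    refine (Set.finite_singleton nil).subset ?_
    rintro (_ | _ | _ | _ | _) ⟨h, _⟩ <;> simp_all [shape]
  | pre a r P ih =>
    refine ((ih.image (pre a r)).union (Set.Finite.image2 (past a r) hK ih)).subset ?_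
    rintro (_ | ⟨b, m, Q⟩ | ⟨b, m, i, Q⟩ | _ | _) ⟨h, hk⟩ <;>
      simp only [shape, pre.injEq, reduceCtorEq] at h
    · obtain ⟨rfl, rfl, h⟩ := h
      exact Or.inl ⟨Q, ⟨h, hk⟩, rfl⟩
    · obtain ⟨rfl, rfl, h⟩ := h
      exact Or.inr ⟨i, hk (Set.mem_insert _ _), Q, ⟨h, (Set.subset_insert _ _).trans hk⟩, rfl⟩
  | past a r i P ih =>
    refine Set.finite_empty.subset ?_
    rintro (_ | _ | _ | _ | _) ⟨h, _⟩ <;> simp [shape] at h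
  | choice P P' ih ih' =>
    refine (Set.Finite.image2 choice ih ih').subset ?_
    rintro (_ | _ | _ | ⟨Q, Q'⟩ | _) ⟨h, hk⟩ <;>
      simp only [shape, choice.injEq, reduceCtorEq] at h
    exact ⟨Q, ⟨h.1, Set.subset_union_left.trans hk⟩, Q', ⟨h.2, Set.subset_union_right.trans hk⟩, rfl⟩
  | par L P P' ih ih' =>
    refine (Set.Finite.image2 (par L) ih ih').subset ?_
    rintro (_ | _ | _ | _ | ⟨M, Q, Q'⟩) ⟨h, hk⟩ <;>
      simp only [shape, par.injEq, reduceCtorEq] at h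
    obtain ⟨rfl, h⟩ := h
    exact ⟨Q, ⟨h.1, Set.subset_union_left.trans hk⟩, Q', ⟨h.2, Set.subset_union_right.trans hk⟩, rfl⟩

end Proc

section Semantics

variable {Act : Type u} {Key : Type v} {bk : Act → Rate → Rate}

/-! ### Transitions of sequential processes -/

namespace FStep

variable {R R' : Proc Act Key} {a : Act} {r : Rate} {i : Key}

/-- Injectivity preserves the freshness conditions on keys. Hence injective renaming preserves
reachability. -/
theorem map (h : FStep R a r i R') {f : Key → Key} (hf : f.Injective) :
    FStep (R.map f) a r (f i) (R'.map f) := by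
  induction h with
  | act1 h => exact .act1 (h.map f)
  | act2 _ hj ih => exact .act2 ih (hf.ne hj)
  | choL _ hS ih => exact .choL ih (hS.map f)
  | choR _ hS ih => exact .choR ih (hS.map f)
  | parL _ ha hi ih => exact .parL ih ha (by rwa [Proc.keys_map, hf.mem_set_image])
  | parR _ ha hi ih => exact .parR ih ha (by rwa [Proc.keys_map, hf.mem_set_image])
  | coo _ _ ha ih ih' => exact .coo ih ih' ha

theorem keys_eq (h : FStep R a r i R') : R'.keys = insert i R.keys := by
  induction h with
  | act1 _ => rfl
  | act2 _ _ ih => simp only [Proc.keys, ih, Set.insert_comm]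
  | choL _ _ ih => simp only [Proc.keys, ih, Set.insert_union]
  | choR _ _ ih => simp only [Proc.keys, ih, Set.union_insert]
  | parL _ _ _ ih => simp only [Proc.keys, ih, Set.insert_union]
  | parR _ _ _ ih => simp only [Proc.keys, ih, Set.union_insert]
  | coo _ _ _ ih ih' =>
    simp only [Proc.keys, ih, ih', Set.insert_union, Set.union_insert, Set.insert_idem]

theorem keysDistinct (h : FStep R a r i R') (hR : R.KeysDistinct) : R'.KeysDistinct := by
  induction h with
  | act1 h => exact ⟨by simp [h.keys_eq_empty], h.keysDistinct⟩
  | act2 h hj ih =>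
    refine ⟨?_, ih hR.2⟩
    rw [h.keys_eq, Set.mem_insert_iff, not_or]
    exact ⟨hj.symm, hR.1⟩
  | choL _ hS ih => exact ⟨ih hR.1, hR.2.1, .inr hS⟩
  | choR _ hS ih => exact ⟨hR.1, ih hR.2.1, .inl hS⟩
  | parL => trivial
  | parR => trivial
  | coo => trivial

theorem shape_eq (h : FStep R a r i R') : R'.shape = R.shape := by
  induction h <;> simp_all [Proc.shape]

theorem parFree_iff (h : FStep R a r i R') : R'.ParFree ↔ R.ParFree := by
  induction h <;> simp_all [Proc.ParFree]

theorem pastCount_eq (h : FStep R a r i R') (hR : R.ParFree) :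
    R'.pastCount = R.pastCount + 1 := by
  induction h with
  | act1 _ => rfl
  | act2 _ _ ih => exact congrArg (· + 1) (ih hR)
  | choL _ _ ih => simp only [Proc.pastCount, ih hR.1]; omega
  | choR _ _ ih => simp only [Proc.pastCount, ih hR.2]; omega
  | parL => exact hR.elim
  | parR => exact hR.elim
  | coo => exact hR.elim

/-- The new action lies below all executed ones, and the idle side of a choice is standard. So the
target alone determines the label. -/
theorem last_eq (h : FStep R a r i R') (hR : R.ParFree) : R'.last = some (a, r) := by
  induction h with
  | act1 h => simp [Proc.last, h.last_eq_none]
  | act2 _ _ ih => simp [Proc.last, ih hR]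
  | choL _ _ ih => simp [Proc.last, ih hR.1]
  | choR _ hS ih => simp [Proc.last, ih hR.2, hS.last_eq_none]
  | parL => exact hR.elim
  | parR => exact hR.elim
  | coo => exact hR.elim

/-- Detailed balance for a single step: executing `(a, r)` contributes the factor `r / bk a r`. -/
theorem weight_mul_eq (h : FStep R a r i R') (hR : R.ParFree) :
    R'.weight bk * bk a r = R.weight bk * r := by
  induction h with
  | @act1 a r i R h =>
    have : (bk a r : ℝ) ≠ 0 := (bk a r).2.ne'
    simp only [Proc.weight]
    field_simp
  | act2 _ _ ih => simp only [Proc.weight, mul_assoc, ih hR]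
  | choL _ _ ih =>
    simp only [Proc.weight]
    rw [mul_right_comm, ih hR.1, mul_right_comm]
  | choR _ _ ih => simp only [Proc.weight, mul_assoc, ih hR.2]
  | parL => exact hR.elim
  | parR => exact hR.elim
  | coo => exact hR.elim

theorem bStep (h : FStep R a r i R') (hR : R.ParFree) : BStep bk R' a (bk a r) i R := by
  induction h with
  | act1 h => exact .act1 h
  | act2 _ hj ih => exact .act2 (ih hR) hj
  | choL _ hS ih => exact .choL (ih hR.1) hS
  | choR _ hS ih => exact .choR (ih hR.2) hS
  | parL => exact hR.elim
  | parR => exact hR.elim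
  | coo => exact hR.elim

end FStep

/-- The forward rate is only asserted to exist: `bk a` need not be injective, so the backward label
does not determine it. -/
theorem BStep.fStep {R R' : Proc Act Key} {a : Act} {m : Rate} {i : Key}
    (h : BStep bk R a m i R') (hR : R.ParFree) : ∃ r, m = bk a r ∧ FStep R' a r i R := by
  induction h with
  | act1 h => exact ⟨_, rfl, .act1 h⟩
  | act2 _ hj ih =>
    obtain ⟨r, e, h⟩ := ih hR
    exact ⟨r, e, .act2 h hj⟩
  | choL _ hS ih =>
    obtain ⟨r, e, h⟩ := ih hR.1
    exact ⟨r, e, .choL h hS⟩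
  | choR _ hS ih =>
    obtain ⟨r, e, h⟩ := ih hR.2
    exact ⟨r, e, .choR h hS⟩
  | parL => exact hR.elim
  | parR => exact hR.elim
  | coo => exact hR.elim

theorem Reachable.map {R : Proc Act Key} (h : Reachable R) {f : Key → Key} (hf : f.Injective) :
    Reachable (R.map f) := by
  obtain ⟨P, hP, hR⟩ := h
  refine ⟨P.map f, hP.map f, Relation.ReflTransGen.lift (Proc.map f) ?_ _ _ hR⟩
  rintro _ _ ⟨a, r, i, h⟩
  exact ⟨a, r, f i, h.map hf⟩

theorem Reachable.keysDistinct {R : Proc Act Key} (h : Reachable R) : R.KeysDistinct := by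
  obtain ⟨P, hP, hR⟩ := h
  induction hR with
  | refl => exact hP.keysDistinct
  | tail _ h ih =>
    obtain ⟨a, r, i, h⟩ := h
    exact h.keysDistinct ih

/-! ### Equality up to keys -/

theorem Ctx.erase_fill {P Q : Proc Act Key} (C : Ctx Act Key) (h : P.erase = Q.erase) :
    (C.fill P).erase = (C.fill Q).erase := by
  unfold Proc.erase at *
  induction C <;> simp_all [Ctx.fill, Proc.map]

theorem SyncRename.erase_eq {a : Act} {i j : Key} {P Q : Proc Act Key}
    (h : SyncRename a i j P Q) : P.erase = Q.erase := by
  induction h with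
  | @leaf C => exact C.erase_fill rfl
  | node _ _ _ ih ih' =>
    unfold Proc.erase at *
    simp only [Proc.map, ih, ih']

theorem KeyRename.erase_eq {P Q : Proc Act Key} (h : KeyRename P Q) : P.erase = Q.erase := by
  cases h with
  | @single C => exact C.erase_fill rfl
  | @sync C _ _ _ L _ _ _ _ _ _ ha h h' => exact C.erase_fill (SyncRename.node ha h h').erase_eq

/-- The process without the identity of its keys only depends on the class up to keys. -/
def KeyClass.erase : KeyClass Act Key → Proc Act Unit :=
  Quotient.lift (fun R => R.1.erase) fun R S h => by
    change Relation.EqvGen _ R S at h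
    induction h with
    | rel _ _ h => exact h.erase_eq
    | refl => rfl
    | symm _ _ _ ih => exact ih.symm
    | trans _ _ _ _ _ ih ih' => exact ih.trans ih'

@[simp]
theorem erase_keyClass (R : ReachProc Act Key) : (keyClass R).erase = R.1.erase := rfl

/-- Distinctness of keys leaves exactly one prefix with key `i`, so swapping `i` with a fresh `j`
throughout changes just that prefix and is an instance of `KeyRename.single`. A swap, being
injective, keeps the process reachable. -/
theorem exists_eq_fill_past [DecidableEq Key] {i j : Key} {R : Proc Act Key} (hp : R.ParFree)
    (hd : R.KeysDistinct) (hi : i ∈ R.keys) (hj : j ∉ R.keys) :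
    ∃ (C : Ctx Act Key) (a : Act) (r : Rate) (S : Proc Act Key), R = C.fill (.past a r i S) ∧
      R.map (Equiv.swap i j) = C.fill (.past a r j S) ∧ C.NoSync a ∧ i ∉ C.keys ∧ j ∉ C.keys ∧
      i ∉ S.keys ∧ j ∉ S.keys := by
  induction R with
  | nil => exact hi.elim
  | pre a r P ih => simp [Proc.keys, Proc.Std.keys_eq_empty hd] at hi
  | past a r k P ih =>
    rcases eq_or_ne i k with rfl | hik
    · have hjP : j ∉ P.keys := fun h => hj (Set.mem_insert_of_mem _ h)
      exact ⟨.hole, a, r, P, rfl, by simp [Proc.map, Ctx.fill, Proc.map_swap_eq_self hd.1 hjP],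
        trivial, Set.notMem_empty _, Set.notMem_empty _, hd.1, hjP⟩
    · have hjk : j ≠ k := fun h => hj (h ▸ Set.mem_insert _ _)
      obtain ⟨C, b, m, S, e, e', hC, h1, h2, h3, h4⟩ := ih hp hd.2
        (Set.mem_of_mem_insert_of_ne hi hik) fun h => hj (Set.mem_insert_of_mem _ h)
      refine ⟨.past a r k C, b, m, S, by rw [e, Ctx.fill], ?_, hC, ?_, ?_, h3, h4⟩
      · rw [Proc.map, e', Ctx.fill, Equiv.swap_apply_of_ne_of_ne hik.symm hjk.symm]
      · exact fun h => h1 (Set.mem_of_mem_insert_of_ne h hik)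
      · exact fun h => h2 (Set.mem_of_mem_insert_of_ne h hjk)
  | choice P Q ihP ihQ =>
    have hjP : j ∉ P.keys := fun h => hj (Or.inl h)
    have hjQ : j ∉ Q.keys := fun h => hj (Or.inr h)
    rcases hd.2.2 with hS | hS
    · have hPe := hS.keys_eq_empty
      obtain ⟨C, b, m, S, e, e', hC, h1, h2, h3, h4⟩ := ihQ hp.2 hd.2.1
        (hi.resolve_left (by simp [hPe])) hjQ
      refine ⟨.choiceR P C, b, m, S, by rw [e, Ctx.fill], ?_, ⟨hp.1.noSync b, hC⟩, ?_, ?_, h3, h4⟩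
      · rw [Proc.map, e', Ctx.fill, Proc.map_swap_eq_self (by simp [hPe]) hjP]
      · simpa [Ctx.keys, hPe] using h1
      · simpa [Ctx.keys, hPe] using h2
    · have hQe := hS.keys_eq_empty
      obtain ⟨C, b, m, S, e, e', hC, h1, h2, h3, h4⟩ := ihP hp.1 hd.1
        (hi.resolve_right (by simp [hQe])) hjP
      refine ⟨.choiceL C Q, b, m, S, by rw [e, Ctx.fill], ?_, ⟨hC, hp.2.noSync b⟩, ?_, ?_, h3, h4⟩
      · rw [Proc.map, e', Ctx.fill, Proc.map_swap_eq_self (by simp [hQe]) hjQ]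
      · simpa [Ctx.keys, hQe] using h1
      · simpa [Ctx.keys, hQe] using h2
  | par => exact hp.elim

theorem exists_keyClass_eq_swap [DecidableEq Key] {i j : Key} (R : ReachProc Act Key)
    (hp : R.1.ParFree) (hi : i ∈ R.1.keys) (hj : j ∉ R.1.keys) :
    ∃ R' : ReachProc Act Key, keyClass R' = keyClass R ∧
      R'.1.keys = Equiv.swap i j '' R.1.keys := by
  refine ⟨⟨R.1.map (Equiv.swap i j), R.2.map (Equiv.injective _)⟩, ?_, Proc.keys_map _ _⟩
  obtain ⟨C, a, r, S, e, e', hC, h1, h2, h3, h4⟩ :=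
    exists_eq_fill_past hp R.2.keysDistinct hi hj
  refine (Quotient.sound (Relation.EqvGen.rel _ _ ?_)).symm
  change KeyRename R.1 (R.1.map _)
  rw [e', e]
  exact .single hC h1 h2 h3 h4

/-- Keys outside `K` are swapped one by one with unused keys of `K`. The size bound ensures that an
unused key is left; the other alternative serves a finite `Key`, which may have too few elements for
that bound. -/
theorem exists_keyClass_eq_keys_subset {K : Set Key} (R : ReachProc Act Key)
    (hp : R.1.ParFree) (hs : (∀ i, i ∈ K) ∨ R.1.size ≤ K.ncard) :
    ∃ R' : ReachProc Act Key, keyClass R' = keyClass R ∧ R'.1.keys ⊆ K := by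
  classical
  induction hn : (R.1.keys \ K).ncard using Nat.strong_induction_on generalizing R with
  | _ n ih =>
    by_cases hsub : R.1.keys ⊆ K
    · exact ⟨R, rfl, hsub⟩
    obtain ⟨i, hi, hiK⟩ := Set.not_subset.1 hsub
    have hcard : R.1.keys.ncard ≤ K.ncard :=
      (Proc.ncard_keys_le_size _).trans (hs.resolve_left fun h => hiK (h i))
    -- If all of `K` were in use, the cardinality bound would make `K` the whole key set of `R`,
    -- which contains `i`.
    obtain ⟨j, hjK, hj⟩ : ∃ j ∈ K, j ∉ R.1.keys := by
      by_contra! h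
      exact hiK ((Set.eq_of_subset_of_ncard_le h hcard (Proc.finite_keys _)).symm ▸ hi)
    obtain ⟨R', hR', hk⟩ := exists_keyClass_eq_swap R hp hi hj
    have he : R'.1.erase = R.1.erase := congrArg KeyClass.erase hR'
    have hsub' : R'.1.keys \ K ⊂ R.1.keys \ K := by
      rw [hk]
      refine (Set.ssubset_iff_of_subset ?_).2 ⟨i, ⟨hi, hiK⟩, ?_⟩
      · rintro _ ⟨⟨k, hkR, rfl⟩, hkK⟩
        rcases eq_or_ne k i with rfl | hki
        · rw [Equiv.swap_apply_left] at hkK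
          exact (hkK hjK).elim
        · rw [Equiv.swap_apply_of_ne_of_ne hki fun h : k = j => hj (h ▸ hkR)] at hkK ⊢
          exact ⟨hkR, hkK⟩
      · rintro ⟨⟨k, hkR, hk⟩, -⟩
        rw [Equiv.swap_apply_eq_iff, Equiv.swap_apply_left] at hk
        exact hj (hk ▸ hkR)
    obtain ⟨R'', h1, h2⟩ := ih _
      (hn ▸ Set.ncard_lt_ncard hsub' (R.1.finite_keys.subset Set.sdiff_subset)) R'
      (by rwa [← Proc.erase_parFree, he, Proc.erase_parFree])
      (by rwa [← Proc.shape_size, ← Proc.erase_shape, he, Proc.erase_shape, Proc.shape_size]) rfl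
    exact ⟨R'', h1.trans hR', h2⟩

end Semantics

end RMPC

namespace RMPC

section Chain

variable {Act : Type u} {Key : Type v} {bk : Act → Rate → Rate}

/-! ### The Markov chain underlying a sequential process -/

/-- Forward transitions between classes. -/
def ClassForward (s : KeyClass Act Key) (l : Act × Rate) (s' : KeyClass Act Key) : Prop :=
  ∃ R R' : ReachProc Act Key, keyClass R = s ∧ keyClass R' = s' ∧ ∃ i, FStep R.1 l.1 l.2 i R'.1

namespace ClassForward

variable {s s' : KeyClass Act Key} {l : Act × Rate}

/-- Such facts descend from processes to classes because the invariants factor through `erase`. -/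
theorem parFree_iff (h : ClassForward s l s') : s'.erase.ParFree ↔ s.erase.ParFree := by
  obtain ⟨R, R', rfl, rfl, i, h⟩ := h
  simpa only [erase_keyClass, Proc.erase_parFree] using h.parFree_iff

theorem shape_eq (h : ClassForward s l s') : s'.erase.shape = s.erase.shape := by
  obtain ⟨R, R', rfl, rfl, i, h⟩ := h
  simpa only [erase_keyClass, Proc.erase_shape] using h.shape_eq

theorem pastCount_eq (h : ClassForward s l s') (hs : s.erase.ParFree) :
    s'.erase.pastCount = s.erase.pastCount + 1 := by
  obtain ⟨R, R', rfl, rfl, i, h⟩ := h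
  simp only [erase_keyClass, Proc.erase_parFree, Proc.erase_pastCount] at hs ⊢
  exact h.pastCount_eq hs

theorem last_eq (h : ClassForward s l s') (hs : s.erase.ParFree) :
    s'.erase.last = some l := by
  obtain ⟨R, R', rfl, rfl, i, h⟩ := h
  simp only [erase_keyClass, Proc.erase_parFree, Proc.erase_last] at hs ⊢
  exact h.last_eq hs

theorem weight_mul_eq (h : ClassForward s l s') (hs : s.erase.ParFree) :
    s'.erase.weight bk * bk l.1 l.2 = s.erase.weight bk * l.2 := by
  obtain ⟨R, R', rfl, rfl, i, h⟩ := h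
  simp only [erase_keyClass, Proc.erase_parFree, Proc.erase_weight] at hs ⊢
  exact h.weight_mul_eq hs

end ClassForward

variable {s s' : KeyClass Act Key} {l : Act × Rate}

theorem ClassTrans.parFree_right (h : ClassTrans bk s l s') (hs : s.erase.ParFree) :
    s'.erase.ParFree := by
  rcases h with h | ⟨R, R', rfl, rfl, i, h⟩
  · exact (ClassForward.parFree_iff h).2 hs
  · rw [erase_keyClass, Proc.erase_parFree] at hs ⊢
    obtain ⟨r, -, h'⟩ := h.fStep hs
    exact h'.parFree_iff.1 hs

/-- Between classes of sequential processes, the transitions are the forward transitions and their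
inverses. -/
theorem classTrans_iff (hs : s.erase.ParFree) : ClassTrans bk s l s' ↔
    ClassForward s l s' ∨ ∃ r, l.2 = bk l.1 r ∧ ClassForward s' (l.1, r) s := by
  refine or_congr Iff.rfl ⟨?_, ?_⟩
  · rintro ⟨R, R', rfl, rfl, i, h⟩
    rw [erase_keyClass, Proc.erase_parFree] at hs
    obtain ⟨r, e, h'⟩ := h.fStep hs
    exact ⟨r, e, R', R, rfl, rfl, i, h'⟩
  · rintro ⟨r, e, h⟩
    have hs' := h.parFree_iff.1 hs
    obtain ⟨R', R, rfl, rfl, i, h⟩ := h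
    rw [erase_keyClass, Proc.erase_parFree] at hs'
    exact ⟨R, R', rfl, rfl, i, e ▸ h.bStep hs'⟩

theorem ClassTrans.exists_symm (h : ClassTrans bk s l s') (hs : s.erase.ParFree) :
    ∃ l', ClassTrans bk s' l' s := by
  have hs' := h.parFree_right hs
  rcases (classTrans_iff hs).1 h with h | ⟨r, -, h⟩
  · exact ⟨(l.1, bk l.1 l.2), (classTrans_iff hs').2 (.inr ⟨l.2, rfl, h⟩)⟩
  · exact ⟨(l.1, r), .inl h⟩

theorem ClassTrans.shape_eq (h : ClassTrans bk s l s') (hs : s.erase.ParFree) :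
    s'.erase.shape = s.erase.shape := by
  rcases (classTrans_iff hs).1 h with h | ⟨r, -, h⟩
  · exact h.shape_eq
  · exact h.shape_eq.symm

/-- If there is a forward transition, then it is the only transition in its direction. -/
theorem ClassForward.classTrans_iff_eq (h : ClassForward s l s') (hs : s.erase.ParFree)
    (l' : Act × Rate) : ClassTrans bk s l' s' ↔ l' = l := by
  refine ⟨fun h' => ?_, fun e => e ▸ .inl h⟩
  rcases (RMPC.classTrans_iff hs).1 h' with h' | ⟨r, -, h'⟩
  · exact Option.some_injective _ ((h'.last_eq hs).symm.trans (h.last_eq hs))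
  -- Forward steps in both directions would each raise the number of executed actions.
  · have h1 := h.pastCount_eq hs
    have h2 := h'.pastCount_eq (h.parFree_iff.2 hs)
    omega

/-- If there is a forward transition, then its inverse is the only transition in the opposite
direction. -/
theorem ClassForward.classTrans_symm_iff_eq (h : ClassForward s l s') (hs : s.erase.ParFree)
    (l' : Act × Rate) : ClassTrans bk s' l' s ↔ l' = (l.1, bk l.1 l.2) := by
  have hs' := h.parFree_iff.2 hs
  rw [RMPC.classTrans_iff hs']
  refine ⟨fun h' => ?_, fun e => .inr ⟨l.2, by rw [e], by rw [e]; exact h⟩⟩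
  rcases h' with h' | ⟨r, e, h'⟩
  · have h1 := h.pastCount_eq hs
    have h2 := h'.pastCount_eq hs'
    omega
  · have := Option.some_injective _ ((h'.last_eq hs).symm.trans (h.last_eq hs))
    rw [← this]
    exact Prod.ext rfl e

/-! ### Finiteness, strong connectedness and detailed balance of the underlying chain -/

section MState

variable {R : ReachProc Act Key}

theorem MState.parFree (hR : R.1.ParFree) (s : MState bk R) : s.1.erase.ParFree := by
  obtain ⟨s, hs⟩ := s
  change s.erase.ParFree
  induction hs with
  | refl => exact (Proc.erase_parFree _).2 hR
  | tail _ h ih =>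
    obtain ⟨l, h⟩ := h
    exact h.parFree_right ih

theorem MState.shape_eq (hR : R.1.ParFree) (s : MState bk R) :
    s.1.erase.shape = R.1.shape := by
  obtain ⟨s, hs⟩ := s
  change s.erase.shape = _
  induction hs with
  | refl => exact Proc.erase_shape _
  | tail h' h ih =>
    obtain ⟨l, h⟩ := h
    exact (h.shape_eq (MState.parFree hR ⟨_, h'⟩)).trans ih

theorem finite_mState (hR : R.1.ParFree) : Finite (MState bk R) := by
  -- `K` is all of `Key` if that is finite; otherwise it has one key per prefix of `R`, and all
  -- states have as many prefixes as `R`.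
  obtain ⟨K, hK, hs⟩ : ∃ K : Set Key, K.Finite ∧ ((∀ i, i ∈ K) ∨ R.1.size ≤ K.ncard) := by
    cases finite_or_infinite Key
    · exact ⟨Set.univ, Set.finite_univ, .inl Set.mem_univ⟩
    · obtain ⟨K, hK⟩ := Infinite.exists_subset_card_eq Key R.1.size
      exact ⟨K, K.finite_toSet, .inr (by rw [Set.ncard_coe_finset, hK])⟩
  have hrep : ∀ s : MState bk R, ∃ Q : ReachProc Act Key, keyClass Q = s.1 ∧
      Q.1.shape = R.1.shape ∧ Q.1.keys ⊆ K := by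
    intro s
    obtain ⟨Q, hQ⟩ := Quotient.exists_rep s.1
    change keyClass Q = s.1 at hQ
    have hp := s.parFree hR
    have hsh := s.shape_eq hR
    rw [← hQ, erase_keyClass] at hp hsh
    rw [Proc.erase_parFree] at hp
    rw [Proc.erase_shape] at hsh
    obtain ⟨Q', h1, h2⟩ := exists_keyClass_eq_keys_subset (K := K) Q hp
      (by rwa [← Q.1.shape_size, hsh, Proc.shape_size])
    have he : Q'.1.erase = Q.1.erase := congrArg KeyClass.erase h1
    exact ⟨Q', h1.trans hQ, by rw [← Proc.erase_shape, he, Proc.erase_shape, hsh], h2⟩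
  choose f hf hf' using hrep
  have := (Proc.finite_shape_eq (Act := Act) hK R.1.shape).to_subtype
  refine Finite.of_injective
    (fun s => (⟨(f s).1, hf' s⟩ : {Q : Proc Act Key | Q.shape = R.1.shape ∧ Q.keys ⊆ K})) ?_
  intro s s' h
  have : f s = f s' := Subtype.ext (Subtype.mk.inj h)
  exact Subtype.ext (by rw [← hf s, ← hf s', this])

/-- Uniqueness of the label also rules out an infinite support, on which `finsum` would default to
zero. -/
theorem mrate_eq_of_iff_eq {s s' : MState bk R} {l : Act × Rate}
    (h : ∀ l', ClassTrans bk s.1 l' s'.1 ↔ l' = l) : mrate bk R s s' = l.2 := by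
  simp only [mrate, MTrans, h]
  exact finsum_cond_eq_left

theorem mrate_nonneg (s s' : MState bk R) : 0 ≤ mrate bk R s s' :=
  finsum_nonneg fun l => finsum_nonneg fun _ => l.2.2.le

/-- Between two states of a sequential process there is at most one transition per direction. -/
theorem MTrans.iff_eq (hR : R.1.ParFree) {s s' : MState bk R} {l : Act × Rate}
    (h : MTrans bk R s l s') : ∀ l', MTrans bk R s l' s' ↔ l' = l := by
  intro l'
  have hs := s.parFree hR
  rcases (classTrans_iff hs).1 h with h | ⟨r, e, h'⟩
  · exact h.classTrans_iff_eq hs l'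
  · have he : l = (l.1, bk l.1 r) := Prod.ext rfl e
    rw [he]
    exact h'.classTrans_symm_iff_eq (s'.parFree hR) l'

theorem MTrans.mrate_pos (hR : R.1.ParFree) {s s' : MState bk R} {l : Act × Rate}
    (h : MTrans bk R s l s') : 0 < mrate bk R s s' := by
  rw [mrate_eq_of_iff_eq (h.iff_eq hR)]
  exact l.2.2

theorem finite_mTrans (hR : R.1.ParFree) :
    {x : MState bk R × (Act × Rate) × MState bk R | MTrans bk R x.1 x.2.1 x.2.2}.Finite := by
  have := finite_mState (bk := bk) hR
  refine Set.Finite.of_finite_image (f := fun x => (x.1, x.2.2)) (Set.toFinite _) ?_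
  rintro ⟨s, l, s'⟩ h ⟨t, m, t'⟩ h' e
  obtain ⟨rfl, rfl⟩ := Prod.mk.inj e
  rw [((MTrans.iff_eq hR h') l).1 h]

/-- Every transition has an inverse, so any two states are joined through the class of `R`. -/
theorem reflTransGen_mTrans (hR : R.1.ParFree) (s s' : MState bk R) :
    Relation.ReflTransGen (fun x y => ∃ l, MTrans bk R x l y) s s' := by
  have hfrom : ∀ s : MState bk R, Relation.ReflTransGen (fun x y => ∃ l, MTrans bk R x l y)
      ⟨keyClass R, .refl⟩ s := by
    rintro ⟨s, hs⟩
    induction hs with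
    | refl => exact .refl
    | tail h' h ih => exact ih.tail h
  refine Relation.ReflTransGen.trans ?_ (hfrom s')
  have : Std.Symm fun x y : MState bk R => ∃ l, MTrans bk R x l y :=
    ⟨fun x _ ⟨_, h⟩ => ClassTrans.exists_symm h (x.parFree hR)⟩
  exact Relation.ReflTransGen.stdSymm.symm _ _ (hfrom s)

theorem weight_mul_mrate_of_forward (hR : R.1.ParFree) {s s' : MState bk R} {l : Act × Rate}
    (h : ClassForward s.1 l s'.1) :
    s.1.erase.weight bk * mrate bk R s s' = s'.1.erase.weight bk * mrate bk R s' s := by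
  have hs := s.parFree hR
  rw [mrate_eq_of_iff_eq (h.classTrans_iff_eq hs), mrate_eq_of_iff_eq (h.classTrans_symm_iff_eq hs)]
  exact (h.weight_mul_eq hs).symm

theorem weight_detailed_balance (hR : R.1.ParFree) (s s' : MState bk R) :
    s.1.erase.weight bk * mrate bk R s s' = s'.1.erase.weight bk * mrate bk R s' s := by
  by_cases h : ∃ l, ClassTrans bk s.1 l s'.1
  · obtain ⟨l, h⟩ := h
    rcases (classTrans_iff (s.parFree hR)).1 h with h | ⟨r, -, h⟩
    · exact weight_mul_mrate_of_forward hR h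
    · exact (weight_mul_mrate_of_forward hR h).symm
  -- With no transition in one direction there is none in the other, and both rates are empty sums.
  · have h' : ¬∃ l, ClassTrans bk s'.1 l s.1 := fun ⟨l, hl⟩ => h (hl.exists_symm (s'.parFree hR))
    simp only [not_exists] at h h'
    simp [mrate, MTrans, h, h']

end MState

end Chain

end RMPC

theorem mainTheorem3 {Act : Type u} {Key : Type v} (bk : Act → RMPC.Rate → RMPC.Rate)
    (R : RMPC.ReachProc Act Key) (hR : R.1.ParFree) :
    -- finitely many states and transitions, strongly connected: an ergodic chain
    Finite (RMPC.MState bk R) ∧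
    {x : RMPC.MState bk R × (Act × RMPC.Rate) × RMPC.MState bk R |
      RMPC.MTrans bk R x.1 x.2.1 x.2.2}.Finite ∧
    (∀ s s' : RMPC.MState bk R,
      Relation.ReflTransGen (fun x y => ∃ l, RMPC.MTrans bk R x l y) s s') ∧
    (∃! p : RMPC.MState bk R → ℝ, CTMC.IsSteadyState (RMPC.mrate bk R) p) ∧
    -- the chain in equilibrium is stationary and time reversible
    ∀ p : RMPC.MState bk R → ℝ, CTMC.IsSteadyState (RMPC.mrate bk R) p →
      ∀ (Ω : Type w) [MeasurableSpace Ω] (μ : Measure Ω) [IsProbabilityMeasure μ]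
        (X : ℝ≥0 → Ω → RMPC.MState bk R),
        CTMC.IsMarkovChain μ X → CTMC.IsTimeHomogeneous μ X →
        CTMC.HasRates μ X (RMPC.mrate bk R) → (∀ s, μ.real {ω | X 0 ω = s} = p s) →
        CTMC.IsStationary μ X ∧ CTMC.IsTimeReversible μ X := by
  have hfin := RMPC.finite_mState (bk := bk) hR
  have hne : Nonempty (RMPC.MState bk R) := ⟨⟨RMPC.keyClass R, .refl⟩⟩
  have hmeas : MeasurableSingletonClass (RMPC.MState bk R) := ⟨fun _ => trivial⟩
  have hw : ∀ s : RMPC.MState bk R, 0 < s.1.erase.weight bk := fun s => RMPC.Proc.weight_pos _ _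
  have hdb := RMPC.weight_detailed_balance (bk := bk) hR
  have hconn := RMPC.reflTransGen_mTrans (bk := bk) hR
  have hirr : ∀ s s', Relation.ReflTransGen (fun x y => 0 < RMPC.mrate bk R x y) s s' :=
    fun s s' => Relation.ReflTransGen.mono (fun _ _ ⟨_, h⟩ => h.mrate_pos hR) _ _ (hconn s s')
  refine ⟨hfin, RMPC.finite_mTrans hR, hconn,
    CTMC.existsUnique_isSteadyState RMPC.mrate_nonneg hw hdb hirr, ?_⟩
  intro p hp Ω _ μ _ X hX hH hq hinit
  -- The given steady state is a multiple of the weight, hence in detailed balance too.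
  exact CTMC.stationary_and_timeReversible hp.1
    (hp.detailed_balance RMPC.mrate_nonneg hw hdb hirr) hX hH hq hinit
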